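/- Let $\beta>0$, let $K\subseteq\mathbb{C}$ be a set of momenta and let $G(\omega,k)$ be a correlator which, for each $k\in K$, is meromorphic in $\omega\in\mathbb{C}$. Let its pole lines $\omega_n^+(k)$ and zero lines $\omega_n^-(k)$ be continuous in $k\in K$, with only finitely many of them in each disc $|\omega|<R$ at each fixed $k\in K$, and such that for each $k\in K$ the divisor of $G(\cdot,k)$ is the sum of the points $\omega_n^-(k)$ minus the sum of the points $\omega_n^+(k)$, with $G(\cdot,k)$ holomorphic off the points $\omega_n^+(k)$. Thus a pole line is a pole of $G(\cdot,k)$ wherever it meets no zero line, and where a pole line and a zero line meet their contributions cancel ("$0/0$"). Fix $k_*\in K$ with $\omega_n^+(k_*)\neq0$ for all $n$. Suppose that at $k_*$ the thermal product formula $$\rho(\omega)=\frac{G(\omega,k_*)-G(-\omega,k_*)}{2i}=\frac{\mu\,\sinh\frac{\beta\omega}{2}}{\prod_n\left[1-\left(\omega/\omega_n^+(k_*)\right)^2\right]}\qquad(\omega\neq\pm\omega_n^+(k_*)\text{ for all }n)$$ holds with some $\mu\in\mathbb{C}$ and $\sum_n|\omega_n^+(k_*)|^{-2}<\infty$, and that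 $\lambda=-\mu/G(0,k_*)$ is finite and non-zero, i.e. $G(0,k_*)\neq0$ and $\mu\ne0$. Suppose that a pole line and a zero line intersect at $(\omega_*,k_*)$, that is, $\omega_*=\omega_n^+(k_*)=\omega_{n'}^-(k_*)$ for some $n,n'$. For every real sequence $R_N\to\infty$ put $$S(\omega)=\lim_{N\to\infty}\ \prod_{|\omega_n^+(k_*)|<R_N}\left(1-\frac{\omega}{\omega_n^+(k_*)}\right)\prod_{|\omega_n^-(k_*)|<R_N}\left(1+\frac{\omega}{\omega_n^-(k_*)}\right).$$ Then the limits $S(\omega_*)$ and $S(-\omega_*)$ exist, $S(\omega_*)=S(-\omega_*)$, and $$\omega_*=-\frac{2\pi i m}{\beta}\quad\text{for some integer } m.$$ -/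

import Mathlib

open Filter Topology

/-- The spectral density `ρ(ω) = (g(ω) - g(-ω)) / (2i)` of a correlator `g` at fixed momentum. -/
noncomputable def spectralDensity (g : ℂ → ℂ) (ω : ℂ) : ℂ :=
  (g ω - g (-ω)) / (2 * Complex.I)

/-- `p i` (`i : ι`) are the pole lines `ω_i⁺(k)` and `z j` (`j : κ`) are the zero lines `ω_j⁻(k)` of
the correlator `G(ω, k)`, for the momenta `k` in `K`.

At each `k` in `K` the function `G(·, k)` is meromorphic on `ℂ`, and its divisor is the sum of the
zero lines minus the sum of the pole lines at `k`. So a pole line that meets no zero line at `k` is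
a pole of `G(·, k)`, and a zero line that meets no pole line at `k` is a zero. Where a pole line and
a zero line meet, their contributions cancel (the form `0/0`); no condition is put on the value
of `G` there. Off the pole lines `G(·, k)` is holomorphic. -/
structure HasPoleZeroLines {ι κ : Type*} (G : ℂ → ℂ → ℂ) (K : Set ℂ)
    (p : ι → ℂ → ℂ) (z : κ → ℂ → ℂ) : Prop where
  pole_continuousOn : ∀ i, ContinuousOn (p i) K
  zero_continuousOn : ∀ j, ContinuousOn (z j) K
  pole_finite : ∀ k ∈ K, ∀ R : ℝ, {i | ‖p i k‖ < R}.Finite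
  zero_finite : ∀ k ∈ K, ∀ R : ℝ, {j | ‖z j k‖ < R}.Finite
  meromorphicAt : ∀ k ∈ K, ∀ ω, MeromorphicAt (fun w => G w k) ω
  analyticAt : ∀ k ∈ K, ∀ ω, (∀ i, p i k ≠ ω) → AnalyticAt ℂ (fun w => G w k) ω
  order_eq : ∀ k ∈ K, ∀ ω, meromorphicOrderAt (fun w => G w k) ω =
    ((({j | z j k = ω}.ncard : ℤ) - ({i | p i k = ω}.ncard : ℤ) : ℤ) : WithTop ℤ)

/-- The thermal product formula
`ρ(ω) = μ sinh(βω/2) / ∏ₙ (1 - (ω/ωₙ)²)` for the correlator `g` with (nonzero) poles `ωₙ`,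
with an absolutely convergent product; it is an equality of functions off the points `±ωₙ`. -/
structure ThermalProductFormula {ι : Type*} (β : ℝ) (g : ℂ → ℂ) (w : ι → ℂ) (μ : ℂ) : Prop where
  ne_zero : ∀ n, w n ≠ 0
  summable : Summable fun n => (‖w n‖ ^ 2)⁻¹
  formula : ∀ ω : ℂ, (∀ n, ω ≠ w n ∧ ω ≠ -w n) →
    spectralDensity g ω = μ * Complex.sinh (β * ω / 2) / ∏' n, (1 - (ω / w n) ^ 2)

/-- `λ = -μ / g(0)`. -/
noncomputable def spectralLambda (μ : ℂ) (g : ℂ → ℂ) : ℂ := -μ / g 0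

/-- The partial product `π_R(ω) = ∏_{|ωₙ| < R} (1 - ω/ωₙ)`. -/
noncomputable def partialProd {ι : Type*} (w : ι → ℂ) (R : ℝ) (ω : ℂ) : ℂ :=
  ∏ᶠ (n : ι) (_ : ‖w n‖ < R), (1 - ω / w n)

/-- `s` is the value at `ω` of `S(ω) = lim_N π⁺_{R_N}(ω) π⁻_{R_N}(-ω)`, where the poles are `wp`
and the zeros are `wz`. -/
def IsSValue {ι κ : Type*} (wp : ι → ℂ) (wz : κ → ℂ) (R : ℕ → ℝ) (ω s : ℂ) : Prop :=
  Tendsto (fun N => partialProd wp (R N) ω * partialProd wz (R N) (-ω)) atTop (𝓝 s)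

/-! The values of `S` are both zero: every late partial product contains the pole factor that
vanishes at `ω_*`, or the zero factor that vanishes at `-ω_*`. For the quantisation, let `a`, `b`
count the pole lines through `ω_*`, `-ω_*`. The product in the thermal formula carries the factor
`(1 - (ω/ω_*)²)^(a+b)`. The zero line makes the order of `G` at `ω_*` at least `1 - a`; at `-ω_*` it
is at least `-b`, and `a ≥ 1`. So `ρ` times the product, which is `μ sinh (βω/2)`, tends to `0` at
`ω_*` (`ThermalProductFormula.sinh_eq_zero`), and the zeros of `sinh` are known. -/

/-- An infinite product `∏ (1 + f i)` is bounded by the exponential of a majorant of `∑ ‖f i‖`. -/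
lemma norm_tprod_one_add_le_exp {ι : Type*} {f : ι → ℂ} {u : ι → ℝ} (hu : Summable u)
    (hfu : ∀ i, ‖f i‖ ≤ u i) : ‖∏' i, (1 + f i)‖ ≤ Real.exp (∑' i, u i) := by
  have hm : Multipliable fun i => 1 + f i :=
    multipliable_one_add_of_summable (hu.of_nonneg_of_le (fun _ => norm_nonneg _) hfu)
  refine le_of_tendsto hm.hasProd.norm (Eventually.of_forall fun s => ?_)
  rw [← norm_prod]
  have h₁ := Finset.norm_prod_one_add_sub_one_le s f
  have h₂ : ∑ i ∈ s, ‖f i‖ ≤ ∑' i, u i :=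
    (Finset.sum_le_sum fun i _ => hfu i).trans
      (hu.sum_le_tsum s fun i _ => (norm_nonneg _).trans (hfu i))
  have h₃ := norm_sub_norm_le (∏ i ∈ s, (1 + f i)) 1
  rw [norm_one] at h₃
  linarith [Real.exp_le_exp.mpr h₂]

/-- Multiplication by `(w - x) ^ m` kills a function of order larger than `-m` at `x`. -/
lemma tendsto_mul_sub_pow_of_meromorphicOrderAt {f : ℂ → ℂ} {x : ℂ} (hf : MeromorphicAt f x)
    {n : ℤ} (hn : meromorphicOrderAt f x = n) {m : ℕ} (hm : 0 < n + m) :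
    Tendsto (fun w => f w * (w - x) ^ m) (𝓝[≠] x) (𝓝 0) := by
  obtain ⟨g, hg, -, hfg⟩ := (meromorphicOrderAt_eq_int_iff hf).1 hn
  obtain ⟨l, hl⟩ := Int.eq_ofNat_of_zero_le hm.le
  have hl0 : l ≠ 0 := by omega
  have hlim : Tendsto (fun w => (w - x) ^ l * g w) (𝓝[≠] x) (𝓝 0) := by
    have hc : ContinuousAt (fun w => (w - x) ^ l * g w) x :=
      ((continuousAt_id.sub continuousAt_const).pow l).mul hg.continuousAt
    simpa [hl0] using hc.tendsto.mono_left nhdsWithin_le_nhds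
  refine hlim.congr' ?_
  filter_upwards [hfg, self_mem_nhdsWithin] with w hw hwx
  have hne : w - x ≠ 0 := sub_ne_zero.mpr hwx
  rw [hw, smul_eq_mul, mul_right_comm, ← zpow_natCast (w - x) m, ← zpow_add₀ hne, hl,
    zpow_natCast]

/-- A partial product vanishes if one of its factors does. -/
lemma partialProd_eq_zero {ι : Type*} {w : ι → ℂ} {R : ℝ} (hfin : {n | ‖w n‖ < R}.Finite)
    {ω : ℂ} {i : ι} (hi : ‖w i‖ < R) (hω : 1 - ω / w i = 0) : partialProd w R ω = 0 := by
  have h := finprod_mem_eq_finite_toFinset_prod (fun n => 1 - ω / w n) hfin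
  exact h.trans (Finset.prod_eq_zero (hfin.mem_toFinset.mpr hi) hω)

/-- If `x` is both a pole line and a zero line, `S(x) = 0`. -/
lemma isSValue_zero {ι κ : Type*} {wp : ι → ℂ} {wz : κ → ℂ} {R : ℕ → ℝ}
    (hR : Tendsto R atTop atTop) (hfin : ∀ r : ℝ, {n | ‖wp n‖ < r}.Finite) {i : ι}
    (hi : wp i ≠ 0) : IsSValue wp wz R (wp i) 0 := by
  refine tendsto_const_nhds.congr' ?_
  filter_upwards [hR.eventually_gt_atTop ‖wp i‖] with N hN
  rw [partialProd_eq_zero (hfin _) hN (by rw [div_self hi, sub_self]), zero_mul]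

/-- If `x` is a zero line, `S(-x) = 0`. -/
lemma isSValue_neg_zero {ι κ : Type*} {wp : ι → ℂ} {wz : κ → ℂ} {R : ℕ → ℝ}
    (hR : Tendsto R atTop atTop) (hfin : ∀ r : ℝ, {n | ‖wz n‖ < r}.Finite) {j : κ}
    (hj : wz j ≠ 0) : IsSValue wp wz R (-wz j) 0 := by
  refine tendsto_const_nhds.congr' ?_
  filter_upwards [hR.eventually_gt_atTop ‖wz j‖] with N hN
  rw [neg_neg, partialProd_eq_zero (hfin _) hN (by rw [div_self hj, sub_self]), mul_zero]

/-- A family which is finite in every disc is locally avoided. -/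
lemma eventually_forall_ne_of_finite {ι : Type*} {w : ι → ℂ}
    (hfin : ∀ r : ℝ, {n | ‖w n‖ < r}.Finite) (x : ℂ) : ∀ᶠ ω in 𝓝[≠] x, ∀ n, ω ≠ w n := by
  -- Only finitely many values lie in the disc of radius `‖x‖ + 1`; with `x` removed they form a
  -- closed set missing `x`.
  have hF := (((hfin (‖x‖ + 1)).image w).subset (Set.sdiff_subset (t := {x}))).isClosed
  have h₁ : ∀ᶠ ω in 𝓝 x, ω ∉ w '' {n | ‖w n‖ < ‖x‖ + 1} \ {x} :=
    hF.isOpen_compl.mem_nhds (by simp)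
  have h₂ : ∀ᶠ ω : ℂ in 𝓝 x, ‖ω‖ < ‖x‖ + 1 :=
    continuous_norm.continuousAt.eventually_lt continuousAt_const (by simp)
  filter_upwards [nhdsWithin_le_nhds h₁, nhdsWithin_le_nhds h₂, self_mem_nhdsWithin]
    with ω hω₁ hω₂ hω₃ n hn
  exact hω₁ ⟨⟨n, by simpa [← hn] using hω₂, hn.symm⟩, hω₃⟩

lemma summable_norm_div_sq {ι : Type*} {w : ι → ℂ} (hs : Summable fun n => (‖w n‖ ^ 2)⁻¹)
    (ω : ℂ) : Summable fun n => ‖-(ω / w n) ^ 2‖ := by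
  refine (hs.mul_left (‖ω‖ ^ 2)).congr fun n => ?_
  rw [norm_neg, norm_pow, norm_div, div_pow, div_eq_mul_inv]

/-- Near `x ≠ 0`, the product `∏ (1 - (ω / wₙ)²)` is `(1 - (ω / x)²) ^ m` times a bounded function,
where `m` counts the `n` with `wₙ = x` or `wₙ = -x`. -/
lemma exists_bounded_factor {ι : Type*} {w : ι → ℂ} (hs : Summable fun n => (‖w n‖ ^ 2)⁻¹)
    (x : ℂ) (A : Finset ι) (hA : ∀ n ∈ A, w n = x ∨ w n = -x) :
    ∃ (Q : ℂ → ℂ) (C : ℝ), (∀ ω, ‖ω‖ < ‖x‖ + 1 → ‖Q ω‖ ≤ C) ∧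
      ∀ ω, ∏' n, (1 - (ω / w n) ^ 2) = (1 - (ω / x) ^ 2) ^ A.card * Q ω := by
  -- `Q` is the product over the indices outside `A`. A local upper bound is all that is needed, so
  -- its continuity plays no role.
  refine ⟨fun ω => ∏' n : ↑((A : Set ι)ᶜ), (1 + -(ω / w n) ^ 2),
    Real.exp (∑' n : ↑((A : Set ι)ᶜ), (‖x‖ + 1) ^ 2 * (‖w n‖ ^ 2)⁻¹), fun ω hω => ?_, fun ω => ?_⟩
  · have hu : Summable fun n : ↑((A : Set ι)ᶜ) => (‖x‖ + 1) ^ 2 * (‖w n‖ ^ 2)⁻¹ :=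
      (hs.comp_injective Subtype.val_injective).mul_left _
    refine norm_tprod_one_add_le_exp hu fun n => ?_
    rw [norm_neg, norm_pow, norm_div, div_pow, div_eq_mul_inv]
    gcongr
  · have hm : Multipliable ((fun n => 1 + -(ω / w n) ^ 2) ∘ ((↑) : ↑((A : Set ι)ᶜ) → ι)) :=
      multipliable_one_add_of_summable
        ((summable_norm_div_sq hs ω).comp_injective Subtype.val_injective)
    have hprod : ∏ n ∈ A, (1 + -(ω / w n) ^ 2) = (1 - (ω / x) ^ 2) ^ A.card := by
      refine Finset.prod_eq_pow_card fun n hn => ?_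
      rcases hA n hn with h | h <;> rw [h] <;> ring
    have hsplit := (A.multipliable fun n => 1 + -(ω / w n) ^ 2).tprod_mul_tprod_compl hm
    rw [A.tprod_subtype' fun n => 1 + -(ω / w n) ^ 2, hprod] at hsplit
    simpa only [← sub_eq_add_neg] using hsplit.symm

/-- If `g` has order larger than `-m` at `x` and at `-x`, where `m` counts the `n` with
`wₙ = x` or `wₙ = -x`, the thermal product formula forces `sinh (βx/2) = 0`. -/
lemma ThermalProductFormula.sinh_eq_zero {ι : Type*} {β : ℝ} {g : ℂ → ℂ} {w : ι → ℂ} {μ : ℂ}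
    (h : ThermalProductFormula β g w μ) (hμ : μ ≠ 0)
    (hfin : ∀ r : ℝ, {n | ‖w n‖ < r}.Finite) {x : ℂ} (hx : x ≠ 0)
    (hg : MeromorphicAt g x) (hg' : MeromorphicAt g (-x)) {a b : ℤ}
    (ha : meromorphicOrderAt g x = a) (hb : meromorphicOrderAt g (-x) = b)
    (A : Finset ι) (hA : ∀ n ∈ A, w n = x ∨ w n = -x)
    (haA : 0 < a + A.card) (hbA : 0 < b + A.card) :
    Complex.sinh (β * x / 2) = 0 := by
  obtain ⟨Q, C, hQC, hQ⟩ := exists_bounded_factor h.summable x A hA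
  set m := A.card
  have hlim₁ := tendsto_mul_sub_pow_of_meromorphicOrderAt hg ha haA
  have hneg : Tendsto (fun ω : ℂ => -ω) (𝓝[≠] x) (𝓝[≠] (-x)) := by
    refine tendsto_nhdsWithin_iff.mpr
      ⟨continuous_neg.continuousAt.tendsto.mono_left nhdsWithin_le_nhds, ?_⟩
    filter_upwards [self_mem_nhdsWithin] with ω hω
    simpa using hω
  have hlim₂ := (tendsto_mul_sub_pow_of_meromorphicOrderAt hg' hb hbA).comp hneg
  have hcont (F : ℂ → ℂ) (hF : Continuous F) : Tendsto F (𝓝[≠] x) (𝓝 (F x)) :=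
    hF.continuousAt.tendsto.mono_left nhdsWithin_le_nhds
  have hρ : Tendsto (fun ω => spectralDensity g ω * (1 - (ω / x) ^ 2) ^ m) (𝓝[≠] x) (𝓝 0) := by
    -- Each half of `ρ` uses its own splitting: `1 - (ω/x)²` is `ω - x` times `-(x + ω)/x²` for `g
    -- ω`, and `-ω - (-x)` times `(x + ω)/x²` for `g (-ω)`.
    have h₁ := hlim₁.mul (hcont (fun ω => (-(x + ω) / x ^ 2) ^ m / (2 * Complex.I)) (by fun_prop))
    have h₂ := hlim₂.mul (hcont (fun ω => ((x + ω) / x ^ 2) ^ m / (2 * Complex.I)) (by fun_prop))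
    have h₃ := h₁.sub h₂
    simp only [zero_mul, sub_zero] at h₃
    refine h₃.congr fun ω => ?_
    have e₁ : (1 - (ω / x) ^ 2) ^ m = (ω - x) ^ m * (-(x + ω) / x ^ 2) ^ m := by
      rw [← mul_pow]; congr 1; field_simp; ring
    have e₂ : (1 - (ω / x) ^ 2) ^ m = (-ω - -x) ^ m * ((x + ω) / x ^ 2) ^ m := by
      rw [← mul_pow]; congr 1; field_simp; ring
    simp only [Function.comp_apply, spectralDensity]
    rw [sub_div, sub_mul]
    nth_rw 1 [e₁]
    rw [e₂]
    ring
  have hbdd : IsBoundedUnder (· ≤ ·) (𝓝[≠] x) (norm ∘ Q) := by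
    refine isBoundedUnder_of_eventually_le (a := C) (nhdsWithin_le_nhds ?_)
    filter_upwards [continuous_norm.continuousAt.eventually_lt continuousAt_const
      (show ‖x‖ < ‖x‖ + 1 by simp)] with ω hω using hQC ω hω
  have hzero := hρ.zero_mul_isBoundedUnder_le hbdd
  have hfin' : ∀ r : ℝ, {n | ‖-w n‖ < r}.Finite := by simpa using hfin
  have hsinh : Tendsto (fun ω : ℂ => μ * Complex.sinh (β * ω / 2)) (𝓝[≠] x) (𝓝 0) := by
    refine hzero.congr' ?_
    filter_upwards [eventually_forall_ne_of_finite hfin x,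
      eventually_forall_ne_of_finite hfin' x] with ω h₁ h₂
    -- An absolutely convergent product vanishes only if a factor does, that is, at `ω = ±w n`.
    have hP : ∏' n, (1 - (ω / w n) ^ 2) ≠ 0 := by
      simp only [sub_eq_add_neg]
      refine tprod_one_add_ne_zero_of_summable (fun n hn => ?_)
        (summable_norm_div_sq h.summable ω)
      have hsq : ω ^ 2 = w n ^ 2 := by
        have := h.ne_zero n
        rw [← sub_eq_add_neg, sub_eq_zero, div_pow, eq_div_iff (pow_ne_zero 2 this)] at hn
        rw [← hn, one_mul]
      exact (sq_eq_sq_iff_eq_or_eq_neg.mp hsq).elim (h₁ n) (h₂ n)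
    rw [mul_assoc, ← hQ, h.formula ω fun n => ⟨h₁ n, h₂ n⟩, div_mul_cancel₀ _ hP]
  have hval := tendsto_nhds_unique hsinh
    (hcont (fun ω => μ * Complex.sinh (β * ω / 2)) (by fun_prop))
  exact (mul_eq_zero.mp hval.symm).resolve_left hμ

lemma eq_of_sinh_eq_zero {β : ℝ} (hβ : 0 < β) {x : ℂ} (h : Complex.sinh (β * x / 2) = 0) :
    ∃ m : ℤ, x = -(2 * Real.pi * Complex.I * m) / β := by
  have hs : Complex.sin (β * x / 2 * Complex.I) = 0 := by
    rw [Complex.sin_mul_I, h, zero_mul]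
  obtain ⟨m, hm⟩ := Complex.sin_eq_zero_iff.mp hs
  refine ⟨m, ?_⟩
  have hβ' : (β : ℂ) ≠ 0 := by exact_mod_cast hβ.ne'
  rw [eq_div_iff hβ']
  linear_combination (-2 * Complex.I) * hm + x * β * Complex.I_sq

theorem mainTheorem12 {ι κ : Type*} (G : ℂ → ℂ → ℂ) (K : Set ℂ)
    (p : ι → ℂ → ℂ) (z : κ → ℂ → ℂ) (hlines : HasPoleZeroLines G K p z)
    (β : ℝ) (hβ : 0 < β) (ωs ks : ℂ) (hks : ks ∈ K)
    (μ : ℂ) (hTPF : ThermalProductFormula β (fun ω => G ω ks) (fun i => p i ks) μ)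
    (hG0 : G 0 ks ≠ 0) (hlam : spectralLambda μ (fun ω => G ω ks) ≠ 0)
    (i : ι) (j : κ) (hp : p i ks = ωs) (hz : z j ks = ωs)
    (R : ℕ → ℝ) (hR : Tendsto R atTop atTop) :
    (∃ s : ℂ, IsSValue (fun i => p i ks) (fun j => z j ks) R ωs s ∧
      IsSValue (fun i => p i ks) (fun j => z j ks) R (-ωs) s) ∧
    ∃ m : ℤ, ωs = -(2 * Real.pi * Complex.I * m) / β := by
  have hx : ωs ≠ 0 := hp ▸ hTPF.ne_zero i
  have hpfin := hlines.pole_finite ks hks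
  have hzfin := hlines.zero_finite ks hks
  refine ⟨⟨0, ?_, ?_⟩, eq_of_sinh_eq_zero hβ ?_⟩
  · subst hp
    exact isSValue_zero (wp := fun i => p i ks) hR hpfin hx
  · subst hz
    exact isSValue_neg_zero (wz := fun j => z j ks) hR hzfin hx
  have hμ : μ ≠ 0 := by
    rintro rfl
    simp [spectralLambda] at hlam
  have hfiber (ω : ℂ) : {n | p n ks = ω}.Finite :=
    (hpfin (‖ω‖ + 1)).subset fun n hn => by
      simp only [Set.mem_ofPred_eq] at hn ⊢
      simp [hn]
  have hzfiber : {n | z n ks = ωs}.Finite :=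
    (hzfin (‖ωs‖ + 1)).subset fun n hn => by
      simp only [Set.mem_ofPred_eq] at hn ⊢
      simp [hn]
  -- `A` consists of all pole lines through `ωs` or `-ωs`; the two fibres are disjoint because `ωs ≠
  -- 0`.
  have hAfin := (hfiber ωs).union (hfiber (-ωs))
  have hdisj : Disjoint {n | p n ks = ωs} {n | p n ks = -ωs} :=
    Set.disjoint_left.mpr fun n (h₁ : p n ks = ωs) (h₂ : p n ks = -ωs) =>
      hx (self_eq_neg.mp (h₁.symm.trans h₂))
  have hcard : hAfin.toFinset.card = {n | p n ks = ωs}.ncard + {n | p n ks = -ωs}.ncard := by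
    rw [← Set.ncard_eq_toFinset_card _ hAfin, Set.ncard_union_eq hdisj (hfiber _) (hfiber _)]
  have hp0 : 0 < {n | p n ks = ωs}.ncard := (Set.ncard_pos (hfiber ωs)).mpr ⟨i, hp⟩
  have hz0 : 0 < {n | z n ks = ωs}.ncard := (Set.ncard_pos hzfiber).mpr ⟨j, hz⟩
  refine hTPF.sinh_eq_zero hμ hpfin hx (hlines.meromorphicAt ks hks _)
    (hlines.meromorphicAt ks hks _) (hlines.order_eq ks hks ωs) (hlines.order_eq ks hks (-ωs))
    hAfin.toFinset (fun n hn => by simpa using hn) ?_ ?_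
  -- At `ωs` its poles cancel in the sum, leaving its zeros (at least one, by `hz0`) plus the poles
  -- at `-ωs`.
  · rw [hcard]; push_cast; omega
  -- At `-ωs` what remains is its zeros plus the poles at `ωs`, positive by `hp0`.
  · rw [hcard]; push_cast; omega
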